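/- Let $\mathcal{A}$ be a locally finitely presentable (lfp) category, i.e. a (locally small) cocomplete category whose full subcategory of finitely presentable objects is essentially small and in which every object is a colimit of a filtered diagram of finitely presentable objects. Let $\mathcal{A}_{\mathrm{fp}}$ be a small full subcategory representing, up to isomorphism, all finitely presentable objects of $\mathcal{A}$. Let $[\mathcal{A},\mathcal{A}]_{\mathrm{fin}}$ be the category of finitary endofunctors of $\mathcal{A}$ (those preserving filtered colimits) and natural transformations. An object $X$ of a category is finitely generated if its hom-functor $\mathrm{Hom}(X,-)$ preserves colimits of filtered diagrams all of whose connecting morphisms are monomorphisms. A signature is a collection $\Sigma=(\Sigma_n)_{n\in\mathcal{A}_{\mathrm{fp}}}$ of objects of $\mathcal{A}$; its polynomial functor is the finitary endofunctor $$H_\Sigma X=\coprod_{n\in\mathcal{A}_{\mathrm{fp}}}\mathcal{A}(n,X)\bullet\Sigma_n ,$$ where $\bullet$ denotes copowers. The signature $\Sigma$ is super-finitary if $\Sigma_n$ is initial for all but finitely many $n\in\mathcal{A}_{\mathrm{fp}}$ and $\Sigma_n$ is finitely presentable for every $n\in\mathcal{A}_{\mathrm{fp}}$. Then a finitary endofunctor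 $F$ of $\mathcal{A}$ is a finitely generated object of $[\mathcal{A},\mathcal{A}]_{\mathrm{fin}}$ if and only if it is a strong quotient of $H_\Sigma$ for some super-finitary signature $\Sigma$, i.e. there exists a strong epimorphism $H_\Sigma\to F$ in $[\mathcal{A},\mathcal{A}]_{\mathrm{fin}}$. -/

import Mathlib

open CategoryTheory CategoryTheory.Limits

universe w v u u'

/-- An object `X` is finitely generated if `Hom(X, -)` preserves all (`w`-small) filtered
colimits of monomorphisms, i.e. colimits of those filtered diagrams all of whose connecting
morphisms are monomorphisms. -/
def IsFinitelyGeneratedObject {C : Type u} [Category.{u'} C] (X : C) : Prop :=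
  ∀ (J : Type w) [SmallCategory J] [IsFiltered J] (D : J ⥤ C),
    (∀ ⦃i j : J⦄ (f : i ⟶ j), Mono (D.map f)) →
      PreservesColimit D (coyoneda.obj (Opposite.op X))

section

variable (A : Type u) [Category.{v} A]

/-- The property of an endofunctor of being finitary: it preserves filtered colimits. -/
def isFinitaryEndofunctor : ObjectProperty (A ⥤ A) :=
  fun F => PreservesFilteredColimitsOfSize.{v, v} F

/-- The category `[A, A]_fin` of finitary endofunctors of `A` and natural transformations. -/
abbrev FinitaryEndofunctor := (isFinitaryEndofunctor A).FullSubcategory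

end

section

variable {A : Type u} [Category.{v} A]

/-- `P`, regarded as a full subcategory, is a choice of `A_fp`: it is small, and up to
isomorphism its objects are precisely the finitely presentable objects of `A`. -/
structure RepresentsFinitelyPresentable (P : ObjectProperty A) : Prop where
  small : ObjectProperty.Small.{v} P
  isoClosure_eq : P.isoClosure = ObjectProperty.isFinitelyPresentable.{v} A

/-- A signature: a collection of objects `Σ n` of `A` indexed by the objects `n` of `A_fp`
(here the full subcategory `P`). -/
abbrev Signature (P : ObjectProperty A) := P.FullSubcategory → A

/-- A signature is super-finitary if all but finitely many of its components are initial,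
and all its components are finitely presentable. -/
structure Signature.IsSuperFinitary {P : ObjectProperty A} (S : Signature P) : Prop where
  finite_nonInitial : {n : P.FullSubcategory | IsEmpty (IsInitial (S n))}.Finite
  finitelyPresentable (n : P.FullSubcategory) : IsFinitelyPresentable.{v} (S n)

/-- The endofunctor `X ↦ A(n, X) • K` of `A`, where `•` denotes copowers. -/
noncomputable abbrev copowerFunctor [HasColimitsOfSize.{v, v} A] (n K : A) : A ⥤ A :=
  coyoneda.obj (Opposite.op n) ⋙ sigmaConst.{v}.obj K

/-- The polynomial functor `H_Σ X = ∐_{n ∈ A_fp} A(n, X) • Σ n`, as a coproduct of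
endofunctors. -/
noncomputable def Signature.polynomialFunctor [HasColimitsOfSize.{v, v} A] {P : ObjectProperty A}
    (hP : RepresentsFinitelyPresentable P) (S : Signature P) : A ⥤ A :=
  haveI := hP.small
  haveI : HasCoproductsOfShape P.FullSubcategory A := hasCoproductsOfShape_of_small _ _
  ∐ fun n : P.FullSubcategory => copowerFunctor n.obj (S n)

lemma isFinitaryEndofunctor_of_isColimit {K : Type*} [Category* K] [HasColimitsOfShape K A]
    {D : K ⥤ A ⥤ A} (hD : ∀ k, isFinitaryEndofunctor A (D.obj k)) {c : Cocone D}
    (hc : IsColimit c) : isFinitaryEndofunctor A c.pt := by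
  refine ⟨fun J _ _ => ?_⟩
  have hk (k : K) : PreservesColimitsOfShape J (D.obj k) :=
    (hD k).preserves_filtered_colimits J
  have : PreservesColimitsOfShape J D.flip := ⟨fun {F} => ⟨fun {s} hs =>
    ⟨evaluationJointlyReflectsColimits _
      (fun k => isColimitOfPreserves (D.obj k) hs)⟩⟩⟩
  have : PreservesColimitsOfShape J (colim (J := K) (C := A)) :=
    colimConstAdj.leftAdjoint_preservesColimits.preservesColimitsOfShape
  exact preservesColimitsOfShape_of_natIso
    ((colimitIsoFlipCompColim D).symm ≪≫ (colimit.isColimit D).coconePointUniqueUpToIso hc)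

/-- Polynomial functors are finitary. -/
lemma Signature.isFinitaryEndofunctor_polynomialFunctor [HasColimitsOfSize.{v, v} A]
    {P : ObjectProperty A} (hP : RepresentsFinitelyPresentable P) (S : Signature P) :
    isFinitaryEndofunctor A (S.polynomialFunctor hP) := by
  have := hP.small
  have : HasCoproductsOfShape P.FullSubcategory A := hasCoproductsOfShape_of_small _ _
  refine isFinitaryEndofunctor_of_isColimit (fun k => ⟨fun J _ _ => ?_⟩) (colimit.isColimit
    (Discrete.functor fun n : P.FullSubcategory => copowerFunctor n.obj (S n)))
  have hn : ObjectProperty.isFinitelyPresentable.{v} A k.as.obj := by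
    rw [← hP.isoClosure_eq]
    exact P.le_isoClosure _ k.as.property
  have := isFinitelyPresentable_iff_preservesFilteredColimitsOfSize.1 hn
  have : PreservesColimitsOfShape J (sigmaConst.{v}.obj (S k.as)) :=
    (sigmaConstAdj (S k.as)).leftAdjoint_preservesColimits.preservesColimitsOfShape
  change PreservesColimitsOfShape J (copowerFunctor k.as.obj (S k.as))
  infer_instance

/-- The polynomial functor `H_Σ` as an object of `[A, A]_fin`. -/
noncomputable def Signature.polynomial [HasColimitsOfSize.{v, v} A] {P : ObjectProperty A}
    (hP : RepresentsFinitelyPresentable P) (S : Signature P) : FinitaryEndofunctor A :=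
  ⟨S.polynomialFunctor hP, S.isFinitaryEndofunctor_polynomialFunctor hP⟩

end

/-! By Yoneda, maps from the copower `A(n, -) • k` to `F` are maps `k ⟶ F n`. As finitary functors
are determined by their values on `A_fp`, the copowers with `n`, `k` in `A_fp` form a small strong
generator of finitely presentable objects (`isStrongGenerator_copowers`). The rest uses only such a
generator. If `S` is super-finitary, `H_S` is a finite coproduct of finitely presentable copowers,
and strong quotients of finitely presentable objects are finitely generated. Conversely, a finitely
generated `F` is the filtered colimit of the images of its finite sets of generalized elements, so
the identity of `F` factors through one image, which must be all of `F`. These finitely many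
elements `k ⟶ F n`, grouped by `n`, give the signature. -/

namespace CategoryTheory

/-! ### Finitely generated objects and images, given a generator of finitely presentable objects -/

section StrongGenerator

variable {C : Type u} [Category.{u'} C] {P : ObjectProperty C}

lemma ObjectProperty.IsSeparating.mono_of_forall (hP : P.IsSeparating) {X Y : C} (f : X ⟶ Y)
    (hf : ∀ (G : C) (_ : P G) (x y : G ⟶ X), x ≫ f = y ≫ f → x = y) : Mono f :=
  ⟨fun g h e => hP _ _ fun G hG x => hf G hG _ _ (by simp [e])⟩

/-- The canonical morphism from a filtered colimit to `F` is a monomorphism as soon as any two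
generalized elements of the diagram identified in `F` are identified in the diagram. -/
lemma ObjectProperty.IsSeparating.mono_of_isColimit (hP : P.IsSeparating)
    (hfp : P ≤ ObjectProperty.isFinitelyPresentable.{w} C)
    {J : Type w} [SmallCategory J] [IsFiltered J] {D : J ⥤ C} {c : Cocone D} (hc : IsColimit c)
    {F : C} (f : c.pt ⟶ F)
    (hf : ∀ (G : C) (_ : P G) (j : J) (x y : G ⟶ D.obj j),
      x ≫ c.ι.app j ≫ f = y ≫ c.ι.app j ≫ f → ∃ (k : J) (a : j ⟶ k), x ≫ D.map a = y ≫ D.map a) :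
    Mono f := by
  refine hP.mono_of_forall f fun G hG x y h => ?_
  have : IsFinitelyPresentable.{w} G := hfp G hG
  obtain ⟨i, x, rfl⟩ := IsFinitelyPresentable.exists_hom_of_isColimit hc x
  obtain ⟨j, y, rfl⟩ := IsFinitelyPresentable.exists_hom_of_isColimit hc y
  obtain ⟨l, a, ha⟩ := hf G hG (IsFiltered.max i j) (x ≫ D.map (IsFiltered.leftToMax i j))
    (y ≫ D.map (IsFiltered.rightToMax i j)) (by simpa using h)
  have := ha =≫ c.ι.app l
  simpa using this

/-- Elements that agree in the colimit agree at a later stage, and the connecting monomorphism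
cancels. -/
lemma ObjectProperty.IsSeparating.mono_ι_of_isColimit (hP : P.IsSeparating)
    (hfp : P ≤ ObjectProperty.isFinitelyPresentable.{w} C)
    {J : Type w} [SmallCategory J] [IsFiltered J] {D : J ⥤ C}
    (hD : ∀ ⦃i j : J⦄ (a : i ⟶ j), Mono (D.map a)) {c : Cocone D} (hc : IsColimit c) (j : J) :
    Mono (c.ι.app j) := by
  refine hP.mono_of_forall _ fun G hG x y h => ?_
  have : IsFinitelyPresentable.{w} G := hfp G hG
  have ⟨k, a, h'⟩ := (Types.FilteredColimit.isColimit_eq_iff' (isColimitOfPreserves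
    (coyoneda.obj (Opposite.op G)) hc) x y).1 h
  have := hD a
  exact (cancel_mono (D.map a)).1 h'

/-- Strong quotients of finitely presentable objects are finitely generated. -/
lemma ObjectProperty.IsSeparating.isFinitelyGeneratedObject_of_strongEpi (hP : P.IsSeparating)
    (hfp : P ≤ ObjectProperty.isFinitelyPresentable.{w} C) {H F : C}
    [IsFinitelyPresentable.{w} H] (e : H ⟶ F) [StrongEpi e] :
    IsFinitelyGeneratedObject.{w} F := by
  intro J _ _ D hD
  refine ⟨fun {c} hc => ⟨?_⟩⟩
  have hm := hP.mono_ι_of_isColimit hfp hD hc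
  refine Types.FilteredColimit.isColimitOf' _ _ (fun (x : F ⟶ c.pt) => ?_)
    (fun i (x : F ⟶ D.obj i) (y : F ⟶ D.obj i) (h : x ≫ _ = y ≫ _) => ?_)
  · obtain ⟨j, p, hp⟩ := IsFinitelyPresentable.exists_hom_of_isColimit hc (e ≫ x)
    have sq : CommSq p e (c.ι.app j) x := ⟨hp⟩
    exact ⟨j, sq.lift, sq.fac_right.symm⟩
  · exact ⟨i, 𝟙 i, by rw [(cancel_mono (c.ι.app i)).1 h]⟩

lemma strongEpi_coequalizer_π {X Y : C} (a b : X ⟶ Y) [HasCoequalizer a b] :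
    StrongEpi (coequalizer.π a b) := by
  refine StrongEpi.mk' fun U V z _ p q sq => ⟨⟨⟨coequalizer.desc p ?_, ?_, ?_⟩⟩⟩
  · rw [← cancel_mono z, Category.assoc, Category.assoc, sq.w, coequalizer.condition_assoc]
  · simp
  · apply coequalizer.hom_ext
    simp [sq.w]

/-- A single coequalizer of coproducts kills all pairs at once. The quotient may have new pairs
identified in `F`, so this is only one step of an iteration. -/
lemma exists_strongEpi_identifying [HasColimitsOfSize.{w, w} C] [LocallySmall.{w} C]
    (P : ObjectProperty C) [ObjectProperty.Small.{w} P] {F : C} (Q : Over F) :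
    ∃ (Q' : Over F) (π : Q ⟶ Q'), StrongEpi π.left ∧
      ∀ (G : C) (_ : P G) (x y : G ⟶ Q.left), x ≫ Q.hom = y ≫ Q.hom →
        x ≫ π.left = y ≫ π.left := by
  let I := Σ G : Subtype P, { p : (G.1 ⟶ Q.left) × (G.1 ⟶ Q.left) // p.1 ≫ Q.hom = p.2 ≫ Q.hom }
  have : HasCoproductsOfShape I C := hasCoproductsOfShape_of_small.{w} _ _
  let a : (∐ fun i : I => i.1.1) ⟶ Q.left := Limits.Sigma.desc fun i => i.2.1.1
  let b : (∐ fun i : I => i.1.1) ⟶ Q.left := Limits.Sigma.desc fun i => i.2.1.2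
  have : HasFiniteColimits C := hasFiniteColimits_of_hasColimitsOfSize C
  have hw : a ≫ Q.hom = b ≫ Q.hom := by
    ext i
    simp [a, b, i.2.2]
  refine ⟨Over.mk (coequalizer.desc Q.hom hw),
    Over.homMk (coequalizer.π a b) (by simp), strongEpi_coequalizer_π a b, fun G hG x y h => ?_⟩
  · let i : I := ⟨⟨G, hG⟩, ⟨(x, y), h⟩⟩
    have := Limits.Sigma.ι (fun i : I => i.1.1) i ≫= coequalizer.condition a b
    simpa [a, b, i] using this

/-- Iterating the identification step countably often suffices: a pair of elements of the colimit
lives at a finite stage and is identified at the next one. -/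
lemma exists_strongEpi_mono_fac [HasColimitsOfSize.{w, w} C] [LocallySmall.{w} C]
    [ObjectProperty.Small.{w} P] (hP : P.IsSeparating)
    (hfp : P ≤ ObjectProperty.isFinitelyPresentable.{w} C) {H F : C} (f : H ⟶ F) :
    ∃ (I : C) (e : H ⟶ I) (m : I ⟶ F), StrongEpi e ∧ Mono m ∧ e ≫ m = f := by
  choose T π hπ hT using exists_strongEpi_identifying.{w} P (F := F)
  let X : ℕ → Over F := fun n => Nat.rec (Over.mk f) (fun _ Q => T Q) n
  let t (n : ℕ) : X n ⟶ X (n + 1) := π (X n)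
  let S : ℕ ⥤ Over F := Functor.ofSequence t
  have hS (n : ℕ) : S.map (homOfLE (Nat.le_succ n)) = t n := Functor.ofSequence_map_homOfLE_succ t n
  let K : ULift.{w} ℕ ⥤ Over F := Monotone.functor (f := ULift.down) (fun _ _ h => h) ⋙ S
  let D := K ⋙ Over.forget F
  have : IsFiltered (ULift.{w} ℕ) := isFiltered_of_directed_le_nonempty _
  let c := colimit.cocone D
  let hc : IsColimit c := colimit.isColimit D
  let s (n : ℕ) : (⟨n⟩ : ULift.{w} ℕ) ⟶ ⟨n + 1⟩ := homOfLE (Nat.le_succ n)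
  have hs (n : ℕ) : D.map (s n) = (t n).left := congrArg CommaMorphism.left (hS n)
  let m : c.pt ⟶ F := hc.desc ((Over.forgetCocone F).whisker K)
  have hm (n : ℕ) : c.ι.app ⟨n⟩ ≫ m = (X n).hom := hc.fac _ _
  have hcs (n : ℕ) : (t n).left ≫ c.ι.app ⟨n + 1⟩ = c.ι.app ⟨n⟩ := by
    rw [← hs]; exact c.w (s n)
  have hcs' (n : ℕ) {Z : C} (g : c.pt ⟶ Z) :
      (t n).left ≫ c.ι.app ⟨n + 1⟩ ≫ g = c.ι.app ⟨n⟩ ≫ g := by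
    rw [← hcs n]; exact (Category.assoc _ _ _).symm
  have ht (n : ℕ) : StrongEpi (t n).left := hπ _
  let e₀ : H ⟶ c.pt := c.ι.app ⟨0⟩
  have hepi : Epi e₀ := by
    refine ⟨fun g h e => hc.hom_ext fun ⟨n⟩ => ?_⟩
    induction n with
    | zero => exact e
    | succ n ih =>
      exact (cancel_epi (t n).left).1 ((hcs' n g).trans (ih.trans (hcs' n h).symm))
  refine ⟨c.pt, e₀, m, StrongEpi.mk' fun U V z _ p q sq => ?_, ?_, hm 0⟩
  -- Lift stage by stage along the strong epimorphisms; the chosen lifts are compatible because `z`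
  -- is mono.
  · have hl (n : ℕ) : ∃ l : (X n).left ⟶ U, l ≫ z = c.ι.app ⟨n⟩ ≫ q := by
      induction n with
      | zero => exact ⟨p, sq.w⟩
      | succ n ih =>
        obtain ⟨l, hl⟩ := ih
        have sq' : CommSq l (t n).left z (c.ι.app ⟨n + 1⟩ ≫ q) :=
          ⟨hl.trans (hcs' n q).symm⟩
        exact ⟨sq'.lift, sq'.fac_right⟩
    choose l hl using hl
    let d : c.pt ⟶ U := hc.desc
      { pt := U
        ι := { app := fun n => l n.down
               naturality := fun i j a => by
                 have h : D.map a ≫ l j.down = l i.down := (cancel_mono z).1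
                   ((Category.assoc _ _ _).trans ((congrArg (D.map a ≫ ·) (hl j.down)).trans
                     ((c.w_assoc a q).trans (hl i.down).symm)))
                 exact h.trans (Category.comp_id _).symm } }
    have hd (n : ULift.{w} ℕ) : c.ι.app n ≫ d = l n.down := hc.fac _ n
    have hdz : d ≫ z = q := hc.hom_ext fun n => by
      rw [reassoc_of% hd n]; exact hl n.down
    refine ⟨⟨⟨d, ?_, hdz⟩⟩⟩
    rw [← cancel_mono z, Category.assoc, hdz, sq.w]
  · refine hP.mono_of_isColimit hfp hc m fun G hG n x y h => ⟨⟨n.down + 1⟩, s n.down, ?_⟩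
    have h' : x ≫ (X n.down).hom = y ≫ (X n.down).hom := by
      rw [← hm n.down]
      exact h
    rw [hs]
    exact hT (X n.down) G hG x y h'

/-- A finitely generated object is generated by finitely many generalized elements. -/
lemma ObjectProperty.IsStrongGenerator.exists_finset_of_isFinitelyGeneratedObject
    [HasColimitsOfSize.{w, w} C] [LocallySmall.{w} C]
    [ObjectProperty.Small.{w} P] (hP : P.IsStrongGenerator)
    (hfp : P ≤ ObjectProperty.isFinitelyPresentable.{w} C) {F : C}
    (hF : IsFinitelyGeneratedObject.{w} F) :
    ∃ (s : Finset (Σ G : Subtype P, G.1 ⟶ F)), ∀ (I : C) (m : I ⟶ F) [Mono m],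
      (∀ t ∈ s, ∃ x, x ≫ m = t.2) → IsIso m := by
  classical
  let T := Σ G : Subtype P, G.1 ⟶ F
  let σ : Shrink.{w} T ≃ T := (equivShrink T).symm
  -- `m` is the smallest subobject containing the elements of `s`. `Shrink` makes the poset of
  -- finite sets `w`-small.
  have hfac (s : Finset (Shrink.{w} T)) : ∃ (I : C) (m : I ⟶ F), Mono m ∧
      (∀ t ∈ s, ∃ x, x ≫ m = (σ t).2) ∧ ∀ (I' : C) (m' : I' ⟶ F) [Mono m'],
        (∀ t ∈ s, ∃ x, x ≫ m' = (σ t).2) → ∃ l, l ≫ m' = m := by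
    have : HasCoproductsOfShape s C := hasCoproductsOfShape_of_small.{w} _ _
    obtain ⟨I, e, m, _, hm, h⟩ := exists_strongEpi_mono_fac.{w} hP.isSeparating hfp
      (Limits.Sigma.desc fun t : s => (σ t.1).2)
    refine ⟨I, m, hm, fun t ht => ⟨Limits.Sigma.ι (fun t : s => (σ t.1).1.1) ⟨t, ht⟩ ≫ e, by simp [h]⟩,
      fun I' m' _ h' => ?_⟩
    choose x hx using h'
    have sq : CommSq (Limits.Sigma.desc fun t : s => x t.1 t.2) e m' m := ⟨by
      rw [h]; ext t; simp [hx]⟩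
    exact ⟨sq.lift, sq.fac_right⟩
  choose I m hm hmem hmin using hfac
  have hle (s s' : Finset (Shrink.{w} T)) (h : s ≤ s') : ∃ l, l ≫ m s' = m s :=
    hmin s _ (m s') fun t ht => hmem s' t (h ht)
  choose l hl using hle
  let D : Finset (Shrink.{w} T) ⥤ C :=
    { obj := I
      map := fun a => l _ _ (leOfHom a)
      map_id := fun s => by rw [← cancel_mono (m s)]; simp [hl]
      map_comp := fun {s s' s''} a b => by rw [← cancel_mono (m s'')]; simp [hl] }
  have hD ⦃s s'⦄ (a : s ⟶ s') : Mono (D.map a) := by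
    have : Mono (l s s' (leOfHom a) ≫ m s') := by rw [hl]; infer_instance
    exact mono_of_mono _ (m s')
  have : IsFiltered (Finset (Shrink.{w} T)) := isFiltered_of_directed_le_nonempty _
  let c := colimit.cocone D
  let hc : IsColimit c := colimit.isColimit D
  let f : c.pt ⟶ F := hc.desc
    { pt := F, ι := { app := m, naturality := fun s s' a => by simp [D, hl] } }
  have hf (s) : c.ι.app s ≫ f = m s := hc.fac _ s
  have : Mono f := hP.isSeparating.mono_of_isColimit hfp hc f fun G hG s x y h =>
    ⟨s, 𝟙 s, by
      have h' : x = y := (cancel_mono (m s)).1 (by simpa only [hf] using h)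
      rw [h']⟩
  have hgen : ∀ t : T, ∃ s, ∃ x, x ≫ m s = t.2 :=
    σ.surjective.forall.2 fun t => ⟨{t}, hmem {t} t (Finset.mem_singleton_self t)⟩
  have : IsIso f := hP.isIso_of_mono f fun G hG g => by
    obtain ⟨s, x, hx⟩ := hgen ⟨⟨G, hG⟩, g⟩
    exact ⟨x ≫ c.ι.app _, by simp only [Category.assoc, hf, hx]⟩
  have := hF _ D hD
  -- Finite generation factors `inv f` through one stage, which splits `m s`.
  obtain ⟨s, r, hr⟩ := Types.jointly_surjective_of_isColimit
    (isColimitOfPreserves (coyoneda.obj (Opposite.op F)) hc) (inv f)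
  replace hr : r ≫ c.ι.app s = inv f := hr
  have hrm : r ≫ m s = 𝟙 F := by rw [← hf, reassoc_of% hr, IsIso.inv_hom_id]
  refine ⟨s.map σ.toEmbedding, fun I' m' _ h => ?_⟩
  obtain ⟨l', hl'⟩ := hmin s I' m' fun t ht => h _ (Finset.mem_map_of_mem _ ht)
  have : IsSplitEpi m' := ⟨⟨r ≫ l', by simp [hl', hrm]⟩⟩
  exact isIso_of_mono_of_isSplitEpi m'

end StrongGenerator

end CategoryTheory

attribute [local instance] Cardinal.fact_isRegular_aleph0

/-! ### Copowers of representable functors -/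

section Copower

variable {A : Type u} [Category.{v} A] [HasColimitsOfSize.{v, v} A]

/-- The Yoneda lemma for copowers of representable functors. -/
noncomputable def copowerFunctorHomEquiv (n K : A) (F : A ⥤ A) :
    (copowerFunctor n K ⟶ F) ≃ (K ⟶ F.obj n) where
  toFun α := Limits.Sigma.ι (fun _ : n ⟶ n => K) (𝟙 n) ≫ α.app n
  invFun x :=
    { app X := Limits.Sigma.desc fun f : n ⟶ X => x ≫ F.map f
      naturality X Y g := by
        refine Limits.Sigma.hom_ext _ _ fun f => ?_
        simp [sigmaConst] }
  left_inv α := by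
    ext X
    refine Limits.Sigma.hom_ext _ _ fun f => ?_
    have := Limits.Sigma.ι (fun _ : n ⟶ n => K) (𝟙 n) ≫= α.naturality f
    simpa [sigmaConst] using this.symm
  right_inv x := by simp

lemma copowerFunctorHomEquiv_comp (n K : A) {F G : A ⥤ A} (α : copowerFunctor n K ⟶ F)
    (β : F ⟶ G) :
    copowerFunctorHomEquiv n K G (α ≫ β) = copowerFunctorHomEquiv n K F α ≫ β.app n := by
  simp [copowerFunctorHomEquiv]

instance isClosedUnderColimitsOfShape_isFinitaryEndofunctor (K : Type*) [Category* K]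
    [HasColimitsOfShape K A] : (isFinitaryEndofunctor A).IsClosedUnderColimitsOfShape K where
  colimitsOfShape_le := by
    rintro X ⟨h⟩
    exact isFinitaryEndofunctor_of_isColimit h.prop_diag_obj h.isColimit

instance : HasColimitsOfSize.{v, v} (FinitaryEndofunctor A) where
  has_colimits_of_shape _ _ := inferInstance

lemma isFinitaryEndofunctor_copowerFunctor {n : A} (hn : IsFinitelyPresentable.{v} n) (K : A) :
    isFinitaryEndofunctor A (copowerFunctor n K) := by
  refine ⟨fun J _ _ => ?_⟩
  have := isFinitelyPresentable_iff_preservesFilteredColimitsOfSize.1 hn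
  have : PreservesColimitsOfShape J (sigmaConst.{v}.obj K) :=
    (sigmaConstAdj K).leftAdjoint_preservesColimits.preservesColimitsOfShape
  infer_instance

/-- The functor `X ↦ A(n, X) • K` as an object of `[A, A]_fin`, for `n` finitely presentable. -/
noncomputable def copower {n : A} (hn : IsFinitelyPresentable.{v} n) (K : A) :
    FinitaryEndofunctor A :=
  ⟨copowerFunctor n K, isFinitaryEndofunctor_copowerFunctor hn K⟩

/-- The evaluation functor `[A, A]_fin ⥤ A` at an object. -/
abbrev finitaryEvaluation (n : A) : FinitaryEndofunctor A ⥤ A :=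
  (isFinitaryEndofunctor A).ι ⋙ (evaluation A A).obj n

/-- The Yoneda lemma for copowers of representable functors, in `[A, A]_fin`. -/
noncomputable def copowerHomEquiv {n : A} (hn : IsFinitelyPresentable.{v} n) (K : A)
    (F : FinitaryEndofunctor A) : (copower hn K ⟶ F) ≃ (K ⟶ F.obj.obj n) :=
  (isFinitaryEndofunctor A).fullyFaithfulι.homEquiv.trans (copowerFunctorHomEquiv n K F.obj)

lemma copowerHomEquiv_comp {n : A} (hn : IsFinitelyPresentable.{v} n) (K : A)
    {F G : FinitaryEndofunctor A} (α : copower hn K ⟶ F) (β : F ⟶ G) :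
    copowerHomEquiv hn K G (α ≫ β) = copowerHomEquiv hn K F α ≫ β.hom.app n :=
  copowerFunctorHomEquiv_comp n K α.hom β.hom

lemma copowerHomEquiv_symm_comp {n : A} (hn : IsFinitelyPresentable.{v} n) (K : A)
    {F G : FinitaryEndofunctor A} (x : K ⟶ F.obj.obj n) (β : F ⟶ G) :
    (copowerHomEquiv hn K F).symm x ≫ β = (copowerHomEquiv hn K G).symm (x ≫ β.hom.app n) := by
  rw [Equiv.eq_symm_apply, copowerHomEquiv_comp, Equiv.apply_symm_apply]

/-- `K ↦ A(n, -) • K` is left adjoint to evaluation at `n`, which preserves filtered colimits. -/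
lemma isFinitelyPresentable_copower {n K : A} (hn : IsFinitelyPresentable.{v} n)
    (hK : IsFinitelyPresentable.{v} K) : IsFinitelyPresentable.{v} (copower hn K) := by
  have : (finitaryEvaluation n).IsCardinalAccessible Cardinal.aleph0.{v} :=
    ⟨fun J _ _ => inferInstance⟩
  exact (Adjunction.adjunctionOfEquivLeft (G := finitaryEvaluation n) (copowerHomEquiv hn)
    (fun K _ _ β α => copowerHomEquiv_comp hn K α β)).isCardinalPresentable_leftAdjoint_obj _ K

end Copower

/-! ### The strong generator of finitary endofunctors -/

section Generator

variable {A : Type u} [Category.{v} A] {P : ObjectProperty A}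

namespace RepresentsFinitelyPresentable

lemma isFinitelyPresentable (hP : RepresentsFinitelyPresentable P) {n : A} (hn : P n) :
    IsFinitelyPresentable.{v} n := by
  have := P.le_isoClosure _ hn
  rwa [hP.isoClosure_eq] at this

lemma small_fullSubcategory (hP : RepresentsFinitelyPresentable P) :
    Small.{v} P.FullSubcategory := by
  have := hP.small
  infer_instance

variable [IsLocallyFinitelyPresentable.{v} A]

lemma isCardinalFilteredGenerator (hP : RepresentsFinitelyPresentable P) :
    P.IsCardinalFilteredGenerator Cardinal.aleph0.{v} := by
  obtain ⟨Q, _, hQ⟩ := HasCardinalFilteredGenerator.exists_generator A Cardinal.aleph0.{v}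
  exact hQ.of_le_isoClosure (hP.isoClosure_eq ▸ hQ.le_isCardinalPresentable)
    fun _ => hP.isFinitelyPresentable

lemma exists_isColimit (hP : RepresentsFinitelyPresentable P) (X : A) :
    ∃ (J : Type v) (_ : SmallCategory J) (D : J ⥤ A) (c : D ⟶ (Functor.const J).obj X)
      (_ : IsColimit (Cocone.mk X c)), (∀ j, P (D.obj j)) ∧
      ∀ F : FinitaryEndofunctor A, PreservesColimitsOfShape J F.obj := by
  obtain ⟨J, _, hJ, ⟨h⟩⟩ := hP.isCardinalFilteredGenerator.exists_colimitsOfShape X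
  rw [isCardinalFiltered_aleph0_iff] at hJ
  exact ⟨J, _, h.diag, h.ι, h.isColimit, h.prop_diag_obj,
    fun F => F.property.preserves_filtered_colimits J⟩

/-- Natural transformations between finitary functors are determined by their components
at `A_fp`. -/
lemma hom_ext (hP : RepresentsFinitelyPresentable P) {F G : FinitaryEndofunctor A} {f g : F ⟶ G}
    (h : ∀ n, P n → f.hom.app n = g.hom.app n) : f = g := by
  ext X : 3
  obtain ⟨J, _, D, c, hc, hD, hF⟩ := hP.exists_isColimit X
  have := hF F
  refine (isColimitOfPreserves F.obj hc).hom_ext fun j => ?_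
  have hf := f.hom.naturality (c.app j)
  have hg := g.hom.naturality (c.app j)
  have := h _ (hD j)
  dsimp at hf hg ⊢
  rw [hf, hg, this]

/-- Every object is a filtered colimit of objects of `P`, and both functors preserve it. -/
lemma isIso_of_isIso_app (hP : RepresentsFinitelyPresentable P) {F G : FinitaryEndofunctor A}
    (f : F ⟶ G) (h : ∀ n, P n → IsIso (f.hom.app n)) : IsIso f := by
  rw [← ObjectProperty.isIso_hom_iff, NatTrans.isIso_iff_isIso_app]
  intro X
  obtain ⟨J, _, D, c, hc, hD, hF⟩ := hP.exists_isColimit X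
  have := hF F
  have := hF G
  let e : D ⋙ F.obj ≅ D ⋙ G.obj := NatIso.ofComponents
    (fun j => haveI := h _ (hD j); asIso (f.hom.app (D.obj j)))
  have : f.hom.app X = ((isColimitOfPreserves F.obj hc).coconePointsIsoOfNatIso
      (isColimitOfPreserves G.obj hc) e).hom := by
    refine (isColimitOfPreserves F.obj hc).hom_ext fun j => ?_
    rw [IsColimit.comp_coconePointsIsoOfNatIso_hom]
    exact f.hom.naturality (c.app j)
  rw [this]
  infer_instance

/-- The copowers of functors represented by objects of `A_fp` by objects of `A_fp`. -/
noncomputable def copowers (hP : RepresentsFinitelyPresentable P) :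
    ObjectProperty (FinitaryEndofunctor A) :=
  ObjectProperty.ofObj fun p : P.FullSubcategory × P.FullSubcategory =>
    copower (hP.isFinitelyPresentable p.1.property) p.2.obj

lemma small_copowers (hP : RepresentsFinitelyPresentable P) :
    ObjectProperty.Small.{v} hP.copowers := by
  have := hP.small_fullSubcategory
  exact inferInstanceAs (ObjectProperty.Small.{v} (ObjectProperty.ofObj _))

lemma copowers_le_isFinitelyPresentable (hP : RepresentsFinitelyPresentable P) :
    hP.copowers ≤ ObjectProperty.isFinitelyPresentable.{v} (FinitaryEndofunctor A) := by
  rintro _ ⟨p⟩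
  exact isFinitelyPresentable_copower _ (hP.isFinitelyPresentable p.2.property)

/-- A transformation is determined by its components on the small `P`, even though `A` may be large.
-/
lemma locallySmall_finitaryEndofunctor (hP : RepresentsFinitelyPresentable P) :
    LocallySmall.{v} (FinitaryEndofunctor A) where
  hom_small F G := by
    have := hP.small_fullSubcategory
    exact small_of_injective
      (f := fun (f : F ⟶ G) (n : P.FullSubcategory) => f.hom.app n.obj)
      fun f g h => hP.hom_ext fun n hn => congrFun h ⟨n, hn⟩

lemma isStrongGenerator_copowers (hP : RepresentsFinitelyPresentable P) :
    hP.copowers.IsStrongGenerator := by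
  have hA := hP.isCardinalFilteredGenerator.isStrongGenerator
  have hc {n k : A} (hn : P n) (hk : P k) :
      hP.copowers (copower (hP.isFinitelyPresentable hn) k) :=
    ⟨((⟨n, hn⟩, ⟨k, hk⟩) : P.FullSubcategory × P.FullSubcategory)⟩
  rw [ObjectProperty.isStrongGenerator_iff]
  refine ⟨fun F G f g h => hP.hom_ext fun n hn => hA.isSeparating _ _ fun k hk x => ?_,
    fun F G f _ h => hP.isIso_of_isIso_app f fun n hn => ?_⟩
  · have := h _ (hc hn hk) ((copowerHomEquiv _ _ F).symm x)
    simpa only [copowerHomEquiv_symm_comp, EmbeddingLike.apply_eq_iff_eq] using this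
  -- Under Yoneda, testing the component on `k` amounts to testing `f` on the copower.
  · have : Mono (f.hom.app n) := hA.isSeparating.mono_of_forall _ fun k hk x y e => by
      refine (copowerHomEquiv (hP.isFinitelyPresentable hn) _ F).symm.injective ?_
      rw [← cancel_mono f, copowerHomEquiv_symm_comp, copowerHomEquiv_symm_comp, e]
    refine hA.isIso_of_mono _ fun k hk x => ?_
    obtain ⟨y, hy⟩ := h _ (hc hn hk) ((copowerHomEquiv _ _ G).symm x)
    refine ⟨copowerHomEquiv _ _ F y, ?_⟩
    dsimp at hy ⊢
    rw [← copowerHomEquiv_comp, hy, Equiv.apply_symm_apply]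

end RepresentsFinitelyPresentable

end Generator

/-! ### Polynomial functors and finite coproducts -/

lemma isFinitelyPresentable_of_isColimit_cofan {C : Type u} [Category.{u'} C] [LocallySmall.{w} C]
    {ι : Type v} [Finite ι] {f : ι → C} {c : Cofan f} (hc : IsColimit c)
    (hf : ∀ i, IsFinitelyPresentable.{w} (f i)) : IsFinitelyPresentable.{w} c.pt := by
  have := Fintype.ofFinite ι
  have : Finite (Arrow (Discrete ι)) :=
    Finite.of_injective (fun a : Arrow (Discrete ι) => a.left.as) (by
      rintro ⟨⟨a⟩, ⟨b⟩, ⟨⟨h⟩⟩⟩ ⟨⟨a'⟩, ⟨b'⟩, ⟨⟨h'⟩⟩⟩ e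
      obtain rfl : a = b := h
      obtain rfl : a' = b' := h'
      obtain rfl : a = a' := e
      rfl)
  have := isClosedUnderColimitsOfShape_isCardinalPresentable C (κ := Cardinal.aleph0.{w})
    (J := Discrete ι) (by rwa [hasCardinalLT_aleph0_iff])
  exact ObjectProperty.prop_of_isColimit (isCardinalPresentable C Cardinal.aleph0.{w}) hc
    fun i => hf i.as

namespace Signature

variable {A : Type u} [Category.{v} A] {P : ObjectProperty A}

section

variable [HasColimitsOfSize.{v, v} A] (hP : RepresentsFinitelyPresentable P) (S : Signature P)

/-- Morphisms out of a polynomial functor are families of generalized elements. -/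
noncomputable def polynomialHomEquiv (F : FinitaryEndofunctor A) :
    (S.polynomial hP ⟶ F) ≃ ∀ n : P.FullSubcategory, S n ⟶ F.obj.obj n.obj :=
  haveI := hP.small_fullSubcategory
  haveI : HasCoproductsOfShape P.FullSubcategory A := hasCoproductsOfShape_of_small _ _
  (isFinitaryEndofunctor A).fullyFaithfulι.homEquiv.trans
    { toFun α n := copowerFunctorHomEquiv n.obj (S n) F.obj
        (Limits.Sigma.ι (fun n : P.FullSubcategory => copowerFunctor n.obj (S n)) n ≫ α)
      invFun x := Limits.Sigma.desc fun n => (copowerFunctorHomEquiv n.obj (S n) F.obj).symm (x n)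
      left_inv α := Limits.Sigma.hom_ext _ _ fun n => by simp
      right_inv x := by simp }

lemma polynomialHomEquiv_comp {F G : FinitaryEndofunctor A} (α : S.polynomial hP ⟶ F) (β : F ⟶ G)
    (n : P.FullSubcategory) :
    S.polynomialHomEquiv hP G (α ≫ β) n = S.polynomialHomEquiv hP F α n ≫ β.hom.app n.obj := by
  refine Eq.trans ?_ (copowerFunctorHomEquiv_comp n.obj (S n) _ β.hom)
  exact congrArg (copowerFunctorHomEquiv n.obj (S n) G.obj) (Category.assoc _ _ _).symm

/-- The inclusion of a summand of a polynomial functor. -/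
noncomputable def polynomialι (n : P.FullSubcategory) :
    copower (hP.isFinitelyPresentable n.property) (S n) ⟶ S.polynomial hP :=
  (copowerHomEquiv _ _ _).symm (S.polynomialHomEquiv hP _ (𝟙 _) n)

lemma copowerHomEquiv_polynomialι_comp {F : FinitaryEndofunctor A} (α : S.polynomial hP ⟶ F)
    (n : P.FullSubcategory) :
    copowerHomEquiv _ _ _ (S.polynomialι hP n ≫ α) = S.polynomialHomEquiv hP F α n := by
  rw [copowerHomEquiv_comp, polynomialι, Equiv.apply_symm_apply, ← polynomialHomEquiv_comp,
    Category.id_comp]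

end

variable [IsLocallyFinitelyPresentable.{v} A] (hP : RepresentsFinitelyPresentable P)
  {S : Signature P}

/-- Initial components contribute nothing to maps out of `H_S`, so it is already the coproduct of
its finitely many remaining summands. -/
lemma IsSuperFinitary.isFinitelyPresentable_polynomial (hS : S.IsSuperFinitary) :
    IsFinitelyPresentable.{v} (S.polynomial hP) := by
  classical
  have := hP.locallySmall_finitaryEndofunctor
  let N := {n : P.FullSubcategory | IsEmpty (IsInitial (S n))}
  have : Finite N := hS.finite_nonInitial
  have hN (n : P.FullSubcategory) (hn : n ∉ N) : IsInitial (S n) :=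
    (not_isEmpty_iff.1 hn).some
  let c : Cofan fun n : N => copower (hP.isFinitelyPresentable n.1.property) (S n.1) :=
    Cofan.mk (S.polynomial hP) fun n => S.polynomialι hP n.1
  let d (s : Cofan fun n : N => copower (hP.isFinitelyPresentable n.1.property) (S n.1)) :
      S.polynomial hP ⟶ s.pt :=
    (S.polynomialHomEquiv hP s.pt).symm fun n => if h : n ∈ N then
      copowerHomEquiv _ _ _ (s.inj ⟨n, h⟩) else (hN n h).to _
  have hd s (n : N) : copowerHomEquiv _ _ _ (S.polynomialι hP n.1 ≫ d s) =
      copowerHomEquiv _ _ _ (s.inj n) := by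
    rw [copowerHomEquiv_polynomialι_comp, Equiv.apply_symm_apply, dif_pos n.2]
  have hc : IsColimit c := Cofan.IsColimit.mk c d
    (fun s n => (copowerHomEquiv _ _ _).injective (hd s n)) fun s m hm => by
      refine (S.polynomialHomEquiv hP s.pt).injective (funext fun n => ?_)
      by_cases hn : n ∈ N
      · rw [← copowerHomEquiv_polynomialι_comp, ← copowerHomEquiv_polynomialι_comp, hd s ⟨n, hn⟩]
        exact congrArg _ (hm ⟨n, hn⟩)
      · exact (hN n hn).hom_ext _ _
  exact isFinitelyPresentable_of_isColimit_cofan hc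
    fun n => isFinitelyPresentable_copower _ (hS.finitelyPresentable n.1)

end Signature

/-! ### The signature of a finitely generated endofunctor -/

namespace RepresentsFinitelyPresentable

variable {A : Type u} [Category.{v} A] {P : ObjectProperty A} [IsLocallyFinitelyPresentable.{v} A]

lemma exists_generalizedElement (hP : RepresentsFinitelyPresentable P) {F : FinitaryEndofunctor A}
    (t : Σ G : Subtype hP.copowers, G.1 ⟶ F) :
    ∃ (n k : P.FullSubcategory) (x : k.obj ⟶ F.obj.obj n.obj),
      ∀ (I : FinitaryEndofunctor A) (m : I ⟶ F) (y : k.obj ⟶ I.obj.obj n.obj),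
        y ≫ m.hom.app n.obj = x → ∃ z, z ≫ m = t.2 := by
  obtain ⟨⟨_, ⟨p⟩⟩, g⟩ := t
  have h := hP.isFinitelyPresentable p.1.property
  refine ⟨p.1, p.2, copowerHomEquiv h _ _ g, fun I m y hy => ⟨(copowerHomEquiv h _ _).symm y, ?_⟩⟩
  rw [copowerHomEquiv_symm_comp, hy, Equiv.symm_apply_apply]

lemma exists_strongEpi_polynomial (hP : RepresentsFinitelyPresentable P)
    {F : FinitaryEndofunctor A} (hF : IsFinitelyGeneratedObject.{v} F) :
    ∃ (S : Signature P) (e : S.polynomial hP ⟶ F), S.IsSuperFinitary ∧ StrongEpi e := by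
  have := hP.small_copowers
  have := hP.locallySmall_finitaryEndofunctor
  obtain ⟨s, hs⟩ := hP.isStrongGenerator_copowers.exists_finset_of_isFinitelyGeneratedObject
    hP.copowers_le_isFinitelyPresentable hF
  choose n k x hx using hP.exists_generalizedElement (F := F)
  have (j : P.FullSubcategory) : Finite {t // t ∈ s ∧ n t = j} :=
    (s.finite_toSet.subset fun t ht => ht.1 : {t | t ∈ s ∧ n t = j}.Finite)
  have (j : P.FullSubcategory) : HasCoproductsOfShape {t // t ∈ s ∧ n t = j} A :=
    hasCoproductsOfShape_of_small.{v} _ _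
  let S : Signature P := fun j => ∐ fun t : {t // t ∈ s ∧ n t = j} => (k t.1).obj
  let y (j : P.FullSubcategory) : S j ⟶ F.obj.obj j.obj :=
    Limits.Sigma.desc fun t => x t.1 ≫ eqToHom (by rw [t.2.2])
  let e : S.polynomial hP ⟶ F := (S.polynomialHomEquiv hP F).symm y
  refine ⟨S, e, ⟨(s.finite_toSet.image n).subset fun j hj => ?_, fun j => ?_⟩, ?_⟩
  -- Outside the finite image of `n` the coproduct is empty, hence initial.
  · by_contra hj'
    have : IsEmpty {t // t ∈ s ∧ n t = j} := ⟨fun t => hj' ⟨t.1, t.2.1, t.2.2⟩⟩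
    exact hj.false (isColimitEquivIsInitialOfIsEmpty _ _ (colimit.isColimit _))
  · exact isFinitelyPresentable_of_isColimit_cofan (coproductIsCoproduct _)
      fun t => hP.isFinitelyPresentable (k t.1).property
  · obtain ⟨I, e', m, _, _, fac⟩ := exists_strongEpi_mono_fac.{v}
      hP.isStrongGenerator_copowers.isSeparating hP.copowers_le_isFinitelyPresentable e
    -- The image of `e` contains every chosen element: `t` is the restriction of `y` to its own
    -- summand.
    have : IsIso m := hs I m fun t ht => by
      refine hx t I m (Limits.Sigma.ι (fun t' : {t' // t' ∈ s ∧ n t' = n t} => (k t'.1).obj)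
        ⟨t, ht, rfl⟩ ≫ S.polynomialHomEquiv hP I e' (n t)) ?_
      rw [Category.assoc, ← S.polynomialHomEquiv_comp, fac, Equiv.apply_symm_apply]
      simp [y]
    rw [← fac]
    infer_instance

end RepresentsFinitelyPresentable

theorem corollaryC {A : Type u} [Category.{v} A] [IsLocallyFinitelyPresentable.{v} A]
    (P : ObjectProperty A) (hP : RepresentsFinitelyPresentable P) (F : FinitaryEndofunctor A) :
    IsFinitelyGeneratedObject.{v} F ↔
      ∃ (S : Signature P) (e : S.polynomial hP ⟶ F), S.IsSuperFinitary ∧ StrongEpi e := by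
  refine ⟨hP.exists_strongEpi_polynomial, fun ⟨S, e, hS, _⟩ => ?_⟩
  have := hS.isFinitelyPresentable_polynomial hP
  exact hP.isStrongGenerator_copowers.isSeparating.isFinitelyGeneratedObject_of_strongEpi
    hP.copowers_le_isFinitelyPresentable e
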